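/- Let $\mathcal{L}=(L,\le)$ be a finite (nonempty) lattice. An element $j\in L$ is join irreducible if it is not the least element and $j=x\vee y$ implies $j\in\{x,y\}$; such a $j$ has a unique lower cover $j_*$. Suppose that $\mathcal{L}$ is congruence uniform, i.e. for both $\mathcal{L}$ and its dual there is a bijection between the set of join-irreducible elements and the set of join-irreducible elements of the lattice of congruences. Call two cover relations $x\lessdot y$ and $u\lessdot v$ of $\mathcal{L}$ perspective if either $v\vee x=y$ and $v\wedge x=u$, or $u\vee y=v$ and $u\wedge y=x$. For a cover relation $u\lessdot v$ let $\gamma(u,v)$ be the unique join-irreducible element $j$ such that $(u,v)$ and $(j_*,j)$ are perspective. For $x\in L$ let $x_{\downarrow}=\bigwedge\{y\in L\mid y\lessdot x\}$ and $$\Psi(x)=\bigl\{\gamma(u,v)\mid x_{\downarrow}\le u\lessdot v\le x\bigr\}.$$ Let $\Gamma(x)$ be the canonical join representation of $x$, i.e. the unique set $X\subseteq L$ with $\bigvee X=x$ such that no proper subset of $X$ joins to $x$ and such that, for every $Y\subseteq L$ with $\bigvee Y=x$, each element of $X$ lies below some element of $Y$. (In a finite congruence-uniform lattice $\gamma(u,v)$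 and $\Gamma(x)$ always exist and are unique.) If $\Gamma(x)=\Psi(x)$ for every $x\in L$, then $\mathcal{L}$ is distributive, i.e. $x\wedge(y\vee z)=(x\wedge y)\vee(x\wedge z)$ and $x\vee(y\wedge z)=(x\vee y)\wedge(x\vee z)$ for all $x,y,z\in L$. -/

import Mathlib

/-! ### The lattice of congruences of a lattice -/

namespace LatticeCon

variable {L : Type*} [Lattice L]

theorem toSetoid_injective :
    Function.Injective (LatticeCon.toSetoid : LatticeCon L → Setoid L) := by
  rintro ⟨s, _, _⟩ ⟨t, _, _⟩ h
  cases h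
  rfl

/-- Congruences are ordered by refinement: `c ≤ d` when `c` relates at most the pairs that `d`
relates. -/
instance instPartialOrder : PartialOrder (LatticeCon L) :=
  PartialOrder.lift LatticeCon.toSetoid toSetoid_injective

theorem le_iff {c d : LatticeCon L} : c ≤ d ↔ ∀ x y : L, c.r x y → d.r x y :=
  ⟨fun h _ _ hxy => h hxy, fun h _ _ hxy => h _ _ hxy⟩

/-- The meet of a set of congruences is their intersection. -/
instance instInfSet : InfSet (LatticeCon L) where
  sInf S :=
    { r := fun x y => ∀ c ∈ S, c.r x y
      iseqv :=
        { refl := fun x c _ => c.iseqv.refl x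
          symm := fun h c hc => c.iseqv.symm (h c hc)
          trans := fun h₁ h₂ c hc => c.iseqv.trans (h₁ c hc) (h₂ c hc) }
      inf := fun h₁ h₂ c hc => c.inf (h₁ c hc) (h₂ c hc)
      sup := fun h₁ h₂ c hc => c.sup (h₁ c hc) (h₂ c hc) }

theorem isGLB_sInf (S : Set (LatticeCon L)) : IsGLB S (sInf S) :=
  ⟨fun c hc => le_iff.2 fun _ _ h => h c hc,
    fun _ hd => le_iff.2 fun _ _ h _ hc => le_iff.1 (hd hc) _ _ h⟩

instance instCompleteLattice : CompleteLattice (LatticeCon L) :=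
  completeLatticeOfInf _ isGLB_sInf

end LatticeCon

/-! ### Congruence-uniform lattices -/

namespace CoreLabel

/-- A finite lattice is congruence uniform if, for both the lattice and its dual, there is a
bijection between the join-irreducible elements and the join-irreducible congruences.
(`SupIrred` excludes the least element, respectively the trivial congruence.) -/
def IsCongruenceUniform (L : Type*) [Lattice L] : Prop :=
  Nonempty ({j : L // SupIrred j} ≃ {c : LatticeCon L // SupIrred c}) ∧
    Nonempty ({j : Lᵒᵈ // SupIrred j} ≃ {c : LatticeCon Lᵒᵈ // SupIrred c})

/-! ### Canonical join representations -/

section CanonicalJoin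

variable {L : Type*} [Lattice L]

/-- `X` is the canonical join representation of `x`: it joins to `x`, no proper subset of it
joins to `x`, and the order ideal it generates is contained in the order ideal generated by any
other join representation of `x`. -/
structure IsCanonicalJoinRep (x : L) (X : Set L) : Prop where
  isLUB : IsLUB X x
  irredundant : ∀ Y : Set L, Y ⊂ X → ¬ IsLUB Y x
  canonical : ∀ Y : Set L, IsLUB Y x → lowerClosure X ≤ lowerClosure Y

theorem IsCanonicalJoinRep.subset {x : L} {X Y : Set L} (hX : IsCanonicalJoinRep x X)
    (hY : IsCanonicalJoinRep x Y) : X ⊆ Y := by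
  intro a ha
  obtain ⟨b, hb, hab⟩ := hX.canonical Y hY.isLUB (subset_lowerClosure ha)
  obtain ⟨c, hc, hbc⟩ := hY.canonical X hX.isLUB (subset_lowerClosure hb)
  have hac : a = c := by
    by_contra hne
    refine hX.irredundant (X \ {a}) ⟨Set.sdiff_subset, fun h => (h ha).2 rfl⟩ ⟨?_, ?_⟩
    · exact fun z hz => hX.isLUB.1 hz.1
    · refine fun u hu => hX.isLUB.2 fun z hz => ?_
      by_cases hza : z = a
      · exact hza ▸ (hab.trans hbc).trans (hu ⟨hc, fun h => hne h.symm⟩)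
      · exact hu ⟨hz, hza⟩
  rw [le_antisymm hab (hac ▸ hbc)]
  exact hb

/-- `Γ(x)`: the canonical join representation of `x`. It is unique when it exists
(see `IsCanonicalJoinRep.canonicalJoinRep_eq`); the value is `∅` when there is none. -/
def canonicalJoinRep (x : L) : Set L :=
  ⋃₀ {X | IsCanonicalJoinRep x X}

theorem IsCanonicalJoinRep.canonicalJoinRep_eq {x : L} {X : Set L}
    (hX : IsCanonicalJoinRep x X) : canonicalJoinRep x = X :=
  Set.Subset.antisymm (Set.sUnion_subset fun _ hY => hY.subset hX)
    (Set.subset_sUnion_of_mem hX)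

end CanonicalJoin

/-! ### Core labels -/

section Labels

variable {L : Type*} [Lattice L]

/-- The cover relations `(x, y)` and `(u, v)` are perspective. -/
def Perspective (x y u v : L) : Prop :=
  (v ⊔ x = y ∧ v ⊓ x = u) ∨ (u ⊔ y = v ∧ u ⊓ y = x)

/-- The graph of the labeling `γ`: `j` is a join-irreducible element such that the cover relations
`(u, v)` and `(j', j)` are perspective, where `j'` is the lower cover of `j`. In a finite
congruence-uniform lattice every cover relation `(u, v)` has exactly one such label `j = γ(u, v)`.
-/
def IsCoverLabel (u v j : L) : Prop :=
  SupIrred j ∧ ∃ j' : L, j' ⋖ j ∧ Perspective u v j' j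

variable [BoundedOrder L] [Finite L]

/-- The nucleus of `x`: the meet of all lower covers of `x`. -/
noncomputable def nucleus (x : L) : L :=
  (Set.toFinite {y : L | y ⋖ x}).toFinset.inf id

/-- `Ψ(x)`: the set of labels `γ(u, v)` of the cover relations `(u, v)` in the core of `x`, that
is, with `nucleus x ≤ u ⋖ v ≤ x`. -/
def coreLabels (x : L) : Set L :=
  {j | ∃ u v : L, nucleus x ≤ u ∧ u ⋖ v ∧ v ≤ x ∧ IsCoverLabel u v j}

end Labels

end CoreLabel

/-! The congruence-uniformity hypothesis enters through a count: the congruences of `L` and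
of its dual form isomorphic lattices, so `L` has as many join-irreducible as meet-irreducible
elements (`nonempty_supIrred_equiv_infIrred`).

The hypothesis `Γ = Ψ` enters as follows. Given a lower cover `u` of `x`, at most one element of
`Γ(x)` fails to lie below `u`: if `a` is such an element, then `u ⊔ a = x`, so every member of
`Γ(x)` lies below `u` or below `a` (`eq_of_mem_canonicalJoinRep`). As every cover relation has a
label, this bounds the core of `x`: if `u` and `w` are lower covers of `x` and the interval from
`u ⊓ w` to `u` had length at least two, then the labels of its first and last steps would be two
members of `Γ(x)` not below `w`. Hence `L` is lower semimodular
(`isWeakLowerModularLattice_of_canonicalJoinRep_eq`).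

Let `j` be join irreducible and `m` maximal among the elements that are not above `j`. Then `m` is
meet irreducible with upper cover `m ⊔ j`, and lower semimodularity gives `j ⊓ m ⋖ j`; that is, `j`
is a label of the cover relation `(m, m ⊔ j)`. Labels of a given cover relation being unique, `m`
determines `j`. A choice of one `m` for each `j` is therefore an injection from the join irreducibles
to the meet irreducibles, which is surjective by the count. So each `j` has only one such `m`, which
means that `j` is join prime (`supPrime_of_supIrred`). A finite lattice whose join-irreducible
elements are all join prime is distributive. -/

/-! ### Congruences of the dual lattice -/

namespace LatticeCon

variable {L : Type*} [Lattice L]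

/-- A lattice congruence, regarded as a congruence of the order dual. -/
def dual (c : LatticeCon L) : LatticeCon Lᵒᵈ where
  r x y := c.r (OrderDual.ofDual x) (OrderDual.ofDual y)
  iseqv := ⟨fun _ => c.iseqv.refl _, fun h => c.iseqv.symm h, fun h₁ h₂ => c.iseqv.trans h₁ h₂⟩
  inf h₁ h₂ := c.sup h₁ h₂
  sup h₁ h₂ := c.inf h₁ h₂

variable (L) in
/-- The congruence lattices of a lattice and of its order dual are isomorphic. -/
def dualOrderIso : LatticeCon L ≃o LatticeCon Lᵒᵈ where
  toFun := dual
  invFun c :=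
    { r := fun x y => c.r (OrderDual.toDual x) (OrderDual.toDual y)
      iseqv := ⟨fun _ => c.iseqv.refl _, fun h => c.iseqv.symm h,
        fun h₁ h₂ => c.iseqv.trans h₁ h₂⟩
      inf := fun h₁ h₂ => c.sup h₁ h₂
      sup := fun h₁ h₂ => c.inf h₁ h₂ }
  left_inv _ := rfl
  right_inv _ := rfl
  map_rel_iff' := by
    intro c d
    rw [le_iff, le_iff]
    exact Iff.rfl

end LatticeCon

theorem OrderIso.supIrred_apply {α β : Type*} [SemilatticeSup α] [SemilatticeSup β] (e : α ≃o β)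
    {a : α} : SupIrred (e a) ↔ SupIrred a := by
  refine and_congr (not_congr e.isMin_apply) ⟨fun h b c hbc => ?_, fun h b c hbc => ?_⟩
  · simpa using h (show e b ⊔ e c = e a by rw [← e.map_sup, hbc])
  · have := h (show e.symm b ⊔ e.symm c = a by rw [← e.symm.map_sup, hbc, e.symm_apply_apply])
    simpa [e.symm_apply_eq] using this

/-! ### Covers in finite lattices -/

section Lattice

variable {L : Type*} [Lattice L]

theorem CovBy.sup_eq_of_not_le {u x a : L} (hu : u ⋖ x) (ha : a ≤ x) (hau : ¬ a ≤ u) :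
    u ⊔ a = x :=
  (hu.eq_or_eq le_sup_left (sup_le hu.le ha)).resolve_left fun h => hau (h ▸ le_sup_right)

/-- An element that is maximal among those not above `j` is covered by its join with `j`. -/
theorem Maximal.covBy_sup {j m : L} (hm : Maximal (fun y => ¬ j ≤ y) m) : m ⋖ m ⊔ j :=
  ⟨left_lt_sup.2 hm.prop, fun _ hmb hb => hb.not_ge
    (sup_le hmb.le (not_not.1 (hm.not_prop_of_gt hmb)))⟩

theorem Maximal.infIrred {j m : L} (hm : Maximal (fun y => ¬ j ≤ y) m) : InfIrred m := by
  refine ⟨fun h => h.not_lt hm.covBy_sup.lt, fun b c hbc => ?_⟩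
  by_contra! hne
  refine hm.prop (hbc ▸ le_inf ?_ ?_)
  · exact not_not.1 (hm.not_prop_of_gt (lt_of_le_of_ne (hbc ▸ inf_le_left) hne.1.symm))
  · exact not_not.1 (hm.not_prop_of_gt (lt_of_le_of_ne (hbc ▸ inf_le_right) hne.2.symm))

variable [Finite L]

/-- A minimal element among those below `v` and not below `u` is join irreducible. -/
theorem exists_supIrred_le_not_le {u v : L} (h : ¬ v ≤ u) :
    ∃ j, SupIrred j ∧ j ≤ v ∧ ¬ j ≤ u ∧ ∀ y < j, y ≤ u := by
  obtain ⟨j, hjv, hj⟩ := Finite.exists_le_minimal (p := fun y => ¬ y ≤ u) h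
  have hlt : ∀ y < j, y ≤ u := fun y hy => not_not.1 (hj.not_prop_of_lt hy)
  refine ⟨j, ⟨fun hmin => hj.prop (inf_eq_left.1 (hmin.eq_of_le inf_le_left)), fun b c hbc => ?_⟩,
    hjv, hj.prop, hlt⟩
  by_contra! hne
  refine hj.prop (hbc ▸ sup_le (hlt b ?_) (hlt c ?_))
  · exact lt_of_le_of_ne (hbc ▸ le_sup_left) hne.1
  · exact lt_of_le_of_ne (hbc ▸ le_sup_right) hne.2

/-- In a finite lattice, the lower semimodular law for two lower covers of `x` extends to a lower
cover `c` and an arbitrary element `b` below `x`. -/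
theorem CovBy.inf_covBy_of_not_le [IsWeakLowerModularLattice L] {x c b : L} (hc : c ⋖ x)
    (hb : b ≤ x) (hbc : ¬ b ≤ c) : b ⊓ c ⋖ b := by
  induction x using WellFoundedLT.induction generalizing c with
  | ind x ih =>
    obtain rfl | hlt := hb.eq_or_lt
    · rwa [inf_eq_right.2 hc.le]
    · obtain ⟨d, hbd, hdx⟩ := exists_le_covBy_of_lt hlt
      have hsup : c ⊔ d = x := hc.sup_eq_of_not_le hdx.le fun h => hbc (hbd.trans h)
      have hcov : d ⊓ c ⋖ d := by
        rw [sup_comm] at hsup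
        subst hsup
        exact IsWeakLowerModularLattice.inf_covBy_of_covBy_covBy_sup hdx hc
      have := ih d hdx.lt hcov hbd fun h => hbc (h.trans inf_le_right)
      rwa [← inf_assoc, inf_eq_left.2 hbd] at this

theorem inf_sup_le_of_forall_supPrime (h : ∀ j : L, SupIrred j → SupPrime j) (x y z : L) :
    x ⊓ (y ⊔ z) ≤ (x ⊓ y) ⊔ (x ⊓ z) := by
  by_contra hle
  obtain ⟨j, hj, hjl, hjr, -⟩ := exists_supIrred_le_not_le hle
  obtain ⟨hjx, hjyz⟩ := le_inf_iff.1 hjl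
  rcases (h j hj).le_sup.1 hjyz with hjy | hjz
  · exact hjr ((le_inf hjx hjy).trans le_sup_left)
  · exact hjr ((le_inf hjx hjz).trans le_sup_right)

end Lattice

/-! ### Labels of cover relations -/

namespace CoreLabel

section Labels

variable {L : Type*} [Lattice L]

theorem IsCongruenceUniform.nonempty_supIrred_equiv_infIrred (hL : IsCongruenceUniform L) :
    Nonempty ({j : L // SupIrred j} ≃ {m : L // InfIrred m}) := by
  obtain ⟨⟨e⟩, ⟨f⟩⟩ := hL
  have g : {c : LatticeCon L // SupIrred c} ≃ {c : LatticeCon Lᵒᵈ // SupIrred c} :=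
    (LatticeCon.dualOrderIso L).toEquiv.subtypeEquiv fun _ =>
      (LatticeCon.dualOrderIso L).supIrred_apply.symm
  exact ⟨(e.trans g).trans (f.symm.trans
    (OrderDual.ofDual.subtypeEquiv fun a => supIrred_toDual (a := OrderDual.ofDual a)))⟩

/-- If `u` is a lower cover of `x`, then only one canonical joinand of `x` is not below `u`. -/
theorem eq_of_mem_canonicalJoinRep {x u a b : L} (hu : u ⋖ x) (ha : a ∈ canonicalJoinRep x)
    (hb : b ∈ canonicalJoinRep x) (hau : ¬ a ≤ u) (hbu : ¬ b ≤ u) : a = b := by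
  obtain ⟨X, hX, -⟩ := Set.mem_sUnion.1 ha
  change IsCanonicalJoinRep x X at hX
  rw [hX.canonicalJoinRep_eq] at ha hb
  have key : ∀ {c d : L}, c ∈ X → d ∈ X → ¬ c ≤ u → ¬ d ≤ u → d ≤ c := by
    intro c d hc hd hcu hdu
    have hlub : IsLUB {u, c} x := by
      rw [← hu.sup_eq_of_not_le (hX.isLUB.1 hc) hcu]
      exact isLUB_pair
    obtain ⟨e, he, hde⟩ := hX.canonical _ hlub (subset_lowerClosure hd)
    rcases he with rfl | rfl
    · exact absurd hde hdu
    · exact hde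
  exact le_antisymm (key hb ha hbu hau) (key ha hb hau hbu)

/-- A join-irreducible element is a label of `(u, v)` as soon as it lies below `v` but not below
`u` and its meet with `u` is its lower cover. -/
theorem isCoverLabel_of_inf_covBy {u v j : L} (huv : u ⋖ v) (hj : SupIrred j) (hjv : j ≤ v)
    (hju : ¬ j ≤ u) (hcov : j ⊓ u ⋖ j) : IsCoverLabel u v j :=
  ⟨hj, j ⊓ u, hcov, Or.inl ⟨by rw [sup_comm, huv.sup_eq_of_not_le hjv hju], rfl⟩⟩

theorem exists_isCoverLabel [Finite L] {u v : L} (huv : u ⋖ v) :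
    ∃ j, IsCoverLabel u v j ∧ j ≤ v ∧ ¬ j ≤ u := by
  obtain ⟨j, hj, hjv, hju, hlt⟩ := exists_supIrred_le_not_le huv.lt.not_ge
  refine ⟨j, isCoverLabel_of_inf_covBy huv hj hjv hju ⟨inf_lt_left.2 hju, fun b hb hbj => ?_⟩,
    hjv, hju⟩
  exact hb.not_ge (le_inf hbj.le (hlt b hbj))

variable [BoundedOrder L] [Finite L]

theorem nucleus_le {u x : L} (hu : u ⋖ x) : nucleus x ≤ u :=
  Finset.inf_le (f := id) ((Set.Finite.mem_toFinset _).2 hu)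

/-! ### Lattices in which the core labels are the canonical joinands -/

/-- Lower semimodularity: an element strictly between `u ⊓ w` and `u` would give `u ⊔ w` two
canonical joinands not below `w`. -/
theorem isWeakLowerModularLattice_of_canonicalJoinRep_eq
    (h : ∀ x : L, canonicalJoinRep x = coreLabels x) : IsWeakLowerModularLattice L := by
  refine ⟨fun {u w} hu hw => ?_⟩
  have hle : ¬ u ≤ w := fun hle => hw.lt.ne (sup_eq_right.2 hle).symm
  refine ⟨inf_lt_left.2 hle, fun b hb hbu => ?_⟩
  -- The first and the last step of a maximal chain from `u ⊓ w` through `b` to `u`.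
  obtain ⟨p, hp, hpb⟩ := exists_covBy_le_of_lt hb
  obtain ⟨q, hbq, hq⟩ := exists_le_covBy_of_lt hbu
  obtain ⟨i, hi, hip, hiuw⟩ := exists_isCoverLabel hp
  obtain ⟨j, hj, hju, hjq⟩ := exists_isCoverLabel hq
  have hiq : i ≤ q := hip.trans (hpb.trans hbq)
  have hnuc : nucleus (u ⊔ w) ≤ u ⊓ w := le_inf (nucleus_le hu) (nucleus_le hw)
  have hi' : i ∈ canonicalJoinRep (u ⊔ w) :=
    h (u ⊔ w) ▸ ⟨_, _, hnuc, hp, hpb.trans (hbu.le.trans le_sup_left), hi⟩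
  have hj' : j ∈ canonicalJoinRep (u ⊔ w) :=
    h (u ⊔ w) ▸ ⟨_, _, hnuc.trans (hb.le.trans hbq), hq, le_sup_left, hj⟩
  have hij : i = j := eq_of_mem_canonicalJoinRep hw hi' hj'
    (fun hiw => hiuw (le_inf (hiq.trans hq.le) hiw))
    (fun hjw => hjq ((le_inf hju hjw).trans (hb.le.trans hbq)))
  exact hjq (hij ▸ hiq)

/-- An element that is maximal among those not above the join-irreducible element `j` determines
`j`, as the label of its only upper cover. -/
theorem eq_of_maximal_of_maximal (h : ∀ x : L, canonicalJoinRep x = coreLabels x) {i j m : L}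
    (hi : SupIrred i) (hj : SupIrred j) (hmi : Maximal (fun y => ¬ i ≤ y) m)
    (hmj : Maximal (fun y => ¬ j ≤ y) m) : i = j := by
  have := isWeakLowerModularLattice_of_canonicalJoinRep_eq h
  have key : ∀ {k : L}, SupIrred k → Maximal (fun y => ¬ k ≤ y) m → m ⋖ m ⊔ k →
      k ∈ canonicalJoinRep (m ⊔ k) := fun {k} hk hmk hcov =>
    h (m ⊔ k) ▸ ⟨m, m ⊔ k, nucleus_le hcov, hcov, le_rfl, isCoverLabel_of_inf_covBy hcov hk
      le_sup_right hmk.prop (hcov.inf_covBy_of_not_le le_sup_right hmk.prop)⟩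
  -- Everything strictly above `m` lies above both `i` and `j`.
  have heq : m ⊔ i = m ⊔ j := le_antisymm
    (sup_le le_sup_left (not_not.1 (hmi.not_prop_of_gt hmj.covBy_sup.lt)))
    (sup_le le_sup_left (not_not.1 (hmj.not_prop_of_gt hmi.covBy_sup.lt)))
  exact eq_of_mem_canonicalJoinRep hmi.covBy_sup (key hi hmi hmi.covBy_sup)
    (heq ▸ key hj hmj hmj.covBy_sup) hmi.prop hmj.prop

/-- Since there are as many join irreducibles as meet irreducibles, only one element is maximal
among those not above a given join irreducible, so this set is an ideal. -/
theorem supPrime_of_supIrred (hL : IsCongruenceUniform L)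
    (h : ∀ x : L, canonicalJoinRep x = coreLabels x) {j : L} (hj : SupIrred j) : SupPrime j := by
  have hex : ∀ k : L, ∀ y : L, ¬ k ≤ y → ∃ m, y ≤ m ∧ Maximal (fun y => ¬ k ≤ y) m :=
    fun k y hy => Finite.exists_le_maximal (p := fun y => ¬ k ≤ y) hy
  have hbot : ∀ k : {k : L // SupIrred k}, ∃ m, Maximal (fun y => ¬ k.1 ≤ y) m := fun k =>
    (hex k.1 ⊥ fun hk => k.2.ne_bot (le_bot_iff.1 hk)).imp fun _ hm => hm.2
  choose g hg using hbot
  let g' : {k : L // SupIrred k} → {m : L // InfIrred m} := fun k => ⟨g k, (hg k).infIrred⟩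
  have hinj : Function.Injective g' := fun k l hkl => by
    have hgkl : g k = g l := congrArg Subtype.val hkl
    exact Subtype.ext (eq_of_maximal_of_maximal h k.2 l.2 (hg k) (hgkl ▸ hg l))
  obtain ⟨e⟩ := hL.nonempty_supIrred_equiv_infIrred
  have hsurj : Function.Surjective g' := hinj.surjective_of_finite e
  have huniq : ∀ m, Maximal (fun y => ¬ j ≤ y) m → m = g ⟨j, hj⟩ := fun m hm => by
    obtain ⟨k, hk⟩ := hsurj ⟨m, hm.infIrred⟩
    have hgk : g k = m := congrArg Subtype.val hk
    obtain rfl : k = ⟨j, hj⟩ :=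
      Subtype.ext (eq_of_maximal_of_maximal h k.2 hj (hgk ▸ hg k) hm)
    exact hgk.symm
  refine ⟨hj.not_isMin, fun y z hyz => ?_⟩
  by_contra! hne
  obtain ⟨m, hym, hm⟩ := hex j y hne.1
  obtain ⟨n, hzn, hn⟩ := hex j z hne.2
  exact hm.prop (hyz.trans (sup_le hym ((huniq n hn).trans (huniq m hm).symm ▸ hzn)))

end Labels

end CoreLabel

theorem proposition3p5 {L : Type*} [Lattice L] [BoundedOrder L] [Finite L]
    (hL : CoreLabel.IsCongruenceUniform L)
    (h : ∀ x : L, CoreLabel.canonicalJoinRep x = CoreLabel.coreLabels x) :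
    ∀ x y z : L,
      x ⊓ (y ⊔ z) = (x ⊓ y) ⊔ (x ⊓ z) ∧ x ⊔ (y ⊓ z) = (x ⊔ y) ⊓ (x ⊔ z) := by
  let _ : DistribLattice L := DistribLattice.ofInfSupLe
    (inf_sup_le_of_forall_supPrime fun _ => CoreLabel.supPrime_of_supIrred hL h)
  exact fun x y z => ⟨inf_sup_left x y z, sup_inf_left x y z⟩
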